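/- **The data structure.** Let $d\ge 1$ and let $A$ be a $d$-dimensional array of numbers (elements of a field of characteristic $0$), indexed by $[1:n_1]\times\dots\times[1:n_d]$. A segment tree on $[a:b]$ has root segment $[a:b]$, and each node with segment $[x_1:x_2]$, $x_1<x_2$, has children with segments $[x_1:\lfloor\frac{x_1+x_2}{2}\rfloor]$ and $[\lfloor\frac{x_1+x_2}{2}\rfloor+1:x_2]$. For $d=1$ the structure is the classical segment tree on $[1:n_1]$ with a value and a lazy update at every node. For $d\ge2$ it is a segment tree on $[1:n_1]$ each of whose nodes carries two $(d-1)$-dimensional structures, one for *global* and one for *local* values and lazy updates. The *size* of an innermost node is the number of elements of its region, i.e. of the product of the segments of the nodes that contain it, one per dimension. Initially each lazy update is $0$, global structures hold only zeros, and the local structure of a node with segment $[x_1:x_2]$ represents the array $\sum_{x=x_1}^{x_2}A[x,\cdot]$. **Update** (add $c$ to every element of $\prod_i[s_i:e_i]$). In every layer but the innermost, start at the root. At a node with segment $[x_1:x_2]\subseteq[s_i:e_i]$, recursively update the global inner structure by $c$ (*intended update*) and do not descend further in this layer; at a node with segment disjoint from $[s_i:e_i]$ do nothing; at any other node process both children and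 recursively update the local inner structure by $c\cdot\frac{\min(e_i,x_2)-\max(s_i,x_1)+1}{x_2-x_1+1}$ (*dispersed update*). In the innermost layer apply the classical lazy update: a node with segment inside the range gets $value\mathrel{+}=c\cdot size$ and $lazy\mathrel{+}=c$; a node with segment disjoint from it is skipped; any other node processes its children and then sets its value to the sum of the children's values plus $lazy\cdot size$. **Query** (return the sum over $\prod_i[s_i:e_i]$). In every layer but the innermost, a node with segment inside $[s_i:e_i]$ returns the sum of the recursive queries of its global and its local inner structure (*complete query*); a node with segment disjoint from $[s_i:e_i]$ returns $0$; any other node returns the sum of the recursive query of its global inner structure only (*partial query*) and of the results of its two children. In the innermost layer, let $V$ be the number of elements of the region fixed by the outer layers and $Q$ the number of those that lie in the query range. A node with segment inside the range returns $value\cdot\frac{Q}{V}$ plus (the sum of the lazy updates of its proper ancestors in that tree) $\cdot\, Q\cdot$ (the length of its segment); a node with segment disjoint from the range returns $0$; any other node returns the sum of the results of its children. **Theorem 4.** For every $d\ge1$ there is a constant $C$, depending only on $d$, such that the following holds for all $n\ge2$, all sizes $1\le n_1,\dots,n_d\le n$, all arrays $A$ on $[1:n_1]\times\dots\times[1:n_d]$,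 and every finite sequence of range-add updates on nonempty subarrays, performed one after the other on the structure constructed from $A$. Every query on a nonempty subarray $\prod_i[s_i:e_i]$ returns exactly the sum over that subarray of the current array, i.e. of $A$ after all these updates. Every such query, and every further update on a nonempty subarray, takes at most $C(\log_2 n)^d$ steps, where visiting or building a node, an arithmetic operation on numbers, and a comparison count as one step each. That is, both operations run in worst-case time $O(\log^d n)$ on $d$-dimensional data. -/

import Mathlib

namespace NestedSegTree

universe u

/-! ### Cost model

Unit-cost pointer machine with exact arithmetic: visiting a node (following the pointer to it and
reading its fields), building a node or a record, one arithmetic operation, one comparison and one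
Boolean operation each take one step. -/

/-- A computation that returns `val` after `cost` elementary steps. -/
structure Timed (α : Type u) where
  val : α
  cost : ℕ

instance : Monad Timed where
  pure a := ⟨a, 0⟩
  bind x f := ⟨(f x.val).val, x.cost + (f x.val).cost⟩

/-- One elementary step producing `a`. -/
def tick {α : Type u} (a : α) : Timed α := ⟨a, 1⟩

/-- Entering a node. -/
def visit : Timed Unit := tick ()

/-- The number `b - a + 1` of elements of the range `[a : b]` (used for `a ≤ b`). -/
def width (a b : ℕ) : Timed ℕ := do
  let s ← tick (b - a)
  tick (s + 1)

/-- Is `[x₁ : x₂]` within `[lo : hi]`? -/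
def isWithin (x₁ x₂ lo hi : ℕ) : Timed Bool := do
  let a ← tick (decide (lo ≤ x₁))
  let b ← tick (decide (x₂ ≤ hi))
  tick (a && b)

/-- Is `[x₁ : x₂]` disjoint from `[lo : hi]`? -/
def isOutside (x₁ x₂ lo hi : ℕ) : Timed Bool := do
  let a ← tick (decide (x₂ < lo))
  let b ← tick (decide (hi < x₁))
  tick (a || b)

/-- The midpoint `⌊(x₁ + x₂) / 2⌋`. -/
def midpoint (x₁ x₂ : ℕ) : Timed ℕ := do
  let s ← tick (x₁ + x₂)
  tick (s / 2)

/-- The quotient of two natural numbers, as an element of `K`. -/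
def ratio (K : Type) [Field K] (a b : ℕ) : Timed K := do
  let p ← tick (a : K)
  let q ← tick (b : K)
  tick (p / q)

/-! ### The data structure -/

/-- A binary tree each of whose nodes (leaves included) carries a record of type `ν`.
The segment of a node is not stored: the algorithms pass it down from the root. -/
inductive SegTree (ν : Type) : Type
  | leaf (v : ν) : SegTree ν
  | node (v : ν) (l r : SegTree ν) : SegTree ν

namespace SegTree

/-- The record at the root. -/
def root {ν : Type} : SegTree ν → ν
  | leaf v => v
  | node v _ _ => v

/-- The segment tree on `[x₁ : x₂]`, halving segments at `⌊(x₁ + x₂) / 2⌋`, in which the node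
operating on `[a : b]` carries `f a b`. -/
def build {ν : Type} (f : ℕ → ℕ → ν) (x₁ x₂ : ℕ) : SegTree ν :=
  if x₁ < x₂ then
    node (f x₁ x₂) (build f x₁ ((x₁ + x₂) / 2)) (build f ((x₁ + x₂) / 2 + 1) x₂)
  else
    leaf (f x₁ x₂)
termination_by x₂ - x₁

end SegTree

/-- Record of a node in the innermost layer: the stored value and the lazy update. -/
structure Cell (K : Type) where
  value : K
  lazy : K

/-- Record of a node in any other layer: the next layer, once for the global and once for the
local values. The two inner structures have the same shape; the entries at the same position of
the two are the global and the local value (and lazy update) of one region. -/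
structure Layer (ν : Type) where
  glob : ν
  loc : ν

/-- The nested segment tree for `d`-dimensional data: the classical segment tree for `d = 1`,
and one more layer around the `d`-dimensional structure for dimension `d + 1`. (Dimension `0` is
not used.) -/
def DTree (K : Type) : ℕ → Type
  | 0 => Unit
  | 1 => SegTree (Cell K)
  | d + 2 => SegTree (Layer (DTree K (d + 1)))

section Algorithm

variable {K : Type} [Field K]

/-- The structure that represents the array `A` on `[1 : size 0] × ⋯ × [1 : size (d - 1)]`.
Every value is the sum of the array over the region of the node and every lazy update is zero.
The entries of a region need not be equal, so they are recorded as local values. -/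
def construct : (d : ℕ) → (size : Fin d → ℕ) → (A : (Fin d → ℕ) → K) → DTree K d
  | 0, _, _ => ()
  | 1, size, A =>
      SegTree.build (fun x₁ x₂ => Cell.mk (∑ x ∈ Finset.Icc x₁ x₂, A (fun _ => x)) 0) 1 (size 0)
  | d + 2, size, A =>
      SegTree.build (fun x₁ x₂ => Layer.mk
        (construct (d + 1) (Fin.tail size) (fun _ => 0))
        (construct (d + 1) (Fin.tail size)
          (fun y => ∑ x ∈ Finset.Icc x₁ x₂, A (Fin.cons x y)))) 1 (size 0)

/-! #### Updates -/

/-- Range update in the innermost layer, with classical lazy propagation: add `c` on `[lo : hi]`,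
in the subtree operating on `[x₁ : x₂]`. Here `V` is the number of elements of the region fixed by
the outer layers, so a node on `[x₁ : x₂]` has size `V * (x₂ - x₁ + 1)`. -/
def updateInner (V lo hi : ℕ) (c : K) :
    (x₁ x₂ : ℕ) → SegTree (Cell K) → Timed (SegTree (Cell K))
  | x₁, x₂, .leaf v => do
      visit
      if ← isWithin x₁ x₂ lo hi then
        let w ← width x₁ x₂
        let size ← tick (V * w)
        let s ← tick (size : K)
        let cs ← tick (c * s)
        let value ← tick (v.value + cs)
        let lazy ← tick (v.lazy + c)
        let v' ← tick (Cell.mk value lazy)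
        tick (.leaf v')
      else
        pure (.leaf v)
  | x₁, x₂, .node v l r => do
      visit
      if ← isWithin x₁ x₂ lo hi then
        let w ← width x₁ x₂
        let size ← tick (V * w)
        let s ← tick (size : K)
        let cs ← tick (c * s)
        let value ← tick (v.value + cs)
        let lazy ← tick (v.lazy + c)
        let v' ← tick (Cell.mk value lazy)
        tick (.node v' l r)
      else if ← isOutside x₁ x₂ lo hi then
        pure (.node v l r)
      else
        let mid ← midpoint x₁ x₂
        let mid' ← tick (mid + 1)
        let l' ← updateInner V lo hi c x₁ mid l
        let r' ← updateInner V lo hi c mid' x₂ r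
        let w ← width x₁ x₂
        let size ← tick (V * w)
        let s ← tick (size : K)
        let ls ← tick (v.lazy * s)
        visit
        visit
        let sum ← tick (l'.root.value + r'.root.value)
        let value ← tick (sum + ls)
        let v' ← tick (Cell.mk value v.lazy)
        tick (.node v' l' r')

/-- Range update in an outer layer, restricted to the subtree operating on `[x₁ : x₂]` in this
dimension. `next V' c'` is the update of the next layer by `c'`, for a node whose region has `V'`
elements in the dimensions up to this one. A node within `[lo : hi]` gets an intended update of
its global values; a node that meets `[lo : hi]` without being within it passes the update on to
its children and gets a dispersed update of its local values, scaled by the fraction of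
`[x₁ : x₂]` that is covered by the trimmed range. -/
def updateOuter {ν : Type} (next : ℕ → K → ν → Timed ν) (V lo hi : ℕ) (c : K) :
    (x₁ x₂ : ℕ) → SegTree (Layer ν) → Timed (SegTree (Layer ν))
  | x₁, x₂, .leaf v => do
      visit
      if ← isWithin x₁ x₂ lo hi then
        let w ← width x₁ x₂
        let V' ← tick (V * w)
        let g ← next V' c v.glob
        let v' ← tick (Layer.mk g v.loc)
        tick (.leaf v')
      else
        pure (.leaf v)
  | x₁, x₂, .node v l r => do
      visit
      if ← isWithin x₁ x₂ lo hi then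
        let w ← width x₁ x₂
        let V' ← tick (V * w)
        let g ← next V' c v.glob
        let v' ← tick (Layer.mk g v.loc)
        tick (.node v' l r)
      else if ← isOutside x₁ x₂ lo hi then
        pure (.node v l r)
      else
        let mid ← midpoint x₁ x₂
        let mid' ← tick (mid + 1)
        let l' ← updateOuter next V lo hi c x₁ mid l
        let r' ← updateOuter next V lo hi c mid' x₂ r
        let lo' ← tick (max lo x₁)
        let hi' ← tick (min hi x₂)
        let overlap ← width lo' hi'
        let w ← width x₁ x₂
        let scaling ← ratio K overlap w
        let c' ← tick (c * scaling)
        let V' ← tick (V * w)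
        let g ← next V' c' v.loc
        let v' ← tick (Layer.mk v.glob g)
        tick (.node v' l' r')

/-- `updateFrom d size lo hi V c t` adds `c` to all elements of the box
`[lo 0 : hi 0] × ⋯ × [lo (d - 1) : hi (d - 1)]` in the `d` innermost layers `t`, where the region
fixed by the layers around them has `V` elements. -/
def updateFrom : (d : ℕ) → (size lo hi : Fin d → ℕ) → (V : ℕ) → (c : K) → DTree K d →
    Timed (DTree K d)
  | 0, _, _, _, _, _, t => pure t
  | 1, size, lo, hi, V, c, t => updateInner V (lo 0) (hi 0) c 1 (size 0) t
  | d + 2, size, lo, hi, V, c, t =>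
      updateOuter (fun V' c' s => do
        let size' ← tick (Fin.tail size)
        let lo' ← tick (Fin.tail lo)
        let hi' ← tick (Fin.tail hi)
        updateFrom (d + 1) size' lo' hi' V' c' s) V (lo 0) (hi 0) c 1 (size 0) t

/-- The update operation: add `c` to every element of the box with corners `lo` and `hi`. -/
def update {d : ℕ} (size lo hi : Fin d → ℕ) (c : K) (t : DTree K d) : Timed (DTree K d) :=
  updateFrom d size lo hi 1 c t

/-! #### Queries -/

/-- Range query in the innermost layer on `[lo : hi]`, in the subtree operating on `[x₁ : x₂]`.
`V` is the number of elements of the region fixed by the outer layers, `Q` the number of those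
that lie in the query (trimmed to that region), and `lazy` is the sum of the lazy updates on the
way down. The stored value is diluted by `Q / V`, which is `1` in a complete query; the lazy
updates are multiplied by the size of the part of the query region in the node. -/
def queryInner (V Q lo hi : ℕ) :
    (x₁ x₂ : ℕ) → (lazy : K) → SegTree (Cell K) → Timed K
  | x₁, x₂, lazy, .leaf v => do
      visit
      if ← isWithin x₁ x₂ lo hi then
        let scaling ← ratio K Q V
        let a ← tick (v.value * scaling)
        let w ← width x₁ x₂
        let size ← tick (Q * w)
        let s ← tick (size : K)
        let b ← tick (lazy * s)
        tick (a + b)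
      else
        tick 0
  | x₁, x₂, lazy, .node v l r => do
      visit
      if ← isWithin x₁ x₂ lo hi then
        let scaling ← ratio K Q V
        let a ← tick (v.value * scaling)
        let w ← width x₁ x₂
        let size ← tick (Q * w)
        let s ← tick (size : K)
        let b ← tick (lazy * s)
        tick (a + b)
      else if ← isOutside x₁ x₂ lo hi then
        tick 0
      else
        let mid ← midpoint x₁ x₂
        let mid' ← tick (mid + 1)
        let lazy' ← tick (lazy + v.lazy)
        let a ← queryInner V Q lo hi x₁ mid lazy' l
        let b ← queryInner V Q lo hi mid' x₂ lazy' r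
        tick (a + b)

/-- Range query in an outer layer, restricted to the subtree operating on `[x₁ : x₂]` in this
dimension. `next V' Q' s` is the query of the next layer `s`, for a node whose region has `V'`
elements in the dimensions up to this one, `Q'` of which lie in the query. A node within
`[lo : hi]` gets a complete query, of its global and its local values; a node that meets
`[lo : hi]` without being within it gets a partial query, of its global values only, and the query
continues in its children. -/
def queryOuter {ν : Type} (next : ℕ → ℕ → ν → Timed K) (V Q lo hi : ℕ) :
    (x₁ x₂ : ℕ) → SegTree (Layer ν) → Timed K
  | x₁, x₂, .leaf v => do
      visit
      if ← isWithin x₁ x₂ lo hi then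
        let w ← width x₁ x₂
        let V' ← tick (V * w)
        let Q' ← tick (Q * w)
        let a ← next V' Q' v.glob
        let b ← next V' Q' v.loc
        tick (a + b)
      else
        tick 0
  | x₁, x₂, .node v l r => do
      visit
      if ← isWithin x₁ x₂ lo hi then
        let w ← width x₁ x₂
        let V' ← tick (V * w)
        let Q' ← tick (Q * w)
        let a ← next V' Q' v.glob
        let b ← next V' Q' v.loc
        tick (a + b)
      else if ← isOutside x₁ x₂ lo hi then
        tick 0
      else
        let mid ← midpoint x₁ x₂
        let mid' ← tick (mid + 1)
        let lo' ← tick (max lo x₁)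
        let hi' ← tick (min hi x₂)
        let overlap ← width lo' hi'
        let w ← width x₁ x₂
        let V' ← tick (V * w)
        let Q' ← tick (Q * overlap)
        let p ← next V' Q' v.glob
        let a ← queryOuter next V Q lo hi x₁ mid l
        let b ← queryOuter next V Q lo hi mid' x₂ r
        let pa ← tick (p + a)
        tick (pa + b)

/-- The query on the `d` innermost layers, where the region fixed by the layers around them has
`V` elements, `Q` of which lie in the query. -/
def queryFrom : (d : ℕ) → (size lo hi : Fin d → ℕ) → (V Q : ℕ) → DTree K d → Timed K
  | 0, _, _, _, _, _, _ => pure 0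
  | 1, size, lo, hi, V, Q, t => queryInner V Q (lo 0) (hi 0) 1 (size 0) 0 t
  | d + 2, size, lo, hi, V, Q, t =>
      queryOuter (fun V' Q' s => do
        let size' ← tick (Fin.tail size)
        let lo' ← tick (Fin.tail lo)
        let hi' ← tick (Fin.tail hi)
        queryFrom (d + 1) size' lo' hi' V' Q' s) V Q (lo 0) (hi 0) 1 (size 0) t

/-- The query operation: the sum over the box with corners `lo` and `hi`. -/
def query {d : ℕ} (size lo hi : Fin d → ℕ) (t : DTree K d) : Timed K :=
  queryFrom d size lo hi 1 1 t

end Algorithm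

/-! ### Specification -/

/-- `[lo 0 : hi 0] × ⋯` is a nonempty subarray of `[1 : size 0] × ⋯`. -/
def IsBox {d : ℕ} (size lo hi : Fin d → ℕ) : Prop :=
  ∀ i, 1 ≤ lo i ∧ lo i ≤ hi i ∧ hi i ≤ size i

/-- An update request: add `c` on the box with corners `lo` and `hi`. -/
structure Request (K : Type) (d : ℕ) where
  lo : Fin d → ℕ
  hi : Fin d → ℕ
  c : K

/-- The effect of an update request on the array. -/
def Request.onArray {K : Type} [Add K] {d : ℕ} (A : (Fin d → ℕ) → K) (q : Request K d) :
    (Fin d → ℕ) → K :=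
  fun x => if x ∈ Finset.Icc q.lo q.hi then A x + q.c else A x

/-- The effect of an update request on the data structure. -/
def Request.onTree {K : Type} [Field K] {d : ℕ} (size : Fin d → ℕ) (t : DTree K d)
    (q : Request K d) : DTree K d :=
  (update size q.lo q.hi q.c t).val

end NestedSegTree

/-!
# Nested segment trees: correctness and cost

A nested segment tree whose surrounding region has `V` elements *represents* an array `B` when its
records are consistent with `B` in the following sense. In an outer layer, a node on `[x₁ : x₂]` of
width `w` has inner structures representing arrays `G` (global) and `L` (local) with
`G + L = ∑ x ∈ [x₁ : x₂], B x`. The global part is spread evenly over the segment, so each element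
`x` leaves `B x - G / w` to the levels below, and the two children have to represent this
remainder. In the innermost layer the same holds with the value in place of `G + L` and with
`V * lazy` in place of `G / w`. Such an array `B` lives on the `d` inner layers only: it carries the
sum over the `V` elements of the surrounding region.

With this invariant the two operations are local calculations.

* A query with `Q` of the `V` surrounding elements returns `Q / V` times the sum of `B` over the box
  (`Represents.val_query`): a partial query adds back the share `G / w` that was subtracted for
  the children, once for every covered element.
* An update by `c` turns `B` into `B + V * c * 1_box` (`Represents.update`): an intended update
  raises `G / w` exactly as much as `B`, so the remainder seen by the children does not change;
  a dispersed update raises `L` by the total that goes to the covered elements.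

Every segment tree is halved, so an operation visits at most `4 * k + 1` nodes of a layer whose
segment has at most `2 ^ k` elements (`visits_le`): as long as both ends of the range lie in the same
child, the other child is settled at once; when they part, each child contains one end only, and
from there on at most one child of each node is not settled at once. At each visited node the
operations make at most two calls to the next layer, and `d` layers give `O(log ^ d n)`.
-/

namespace NestedSegTree

/-! ### Evaluating timed computations -/

section Timed

variable {α β : Type}

@[simp] theorem val_bind (x : Timed α) (f : α → Timed β) : (x >>= f).val = (f x.val).val := rfl

@[simp] theorem cost_bind (x : Timed α) (f : α → Timed β) :
    (x >>= f).cost = x.cost + (f x.val).cost := rfl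

@[simp] theorem val_pure (a : α) : (pure a : Timed α).val = a := rfl

@[simp] theorem cost_pure (a : α) : (pure a : Timed α).cost = 0 := rfl

@[simp] theorem val_tick (a : α) : (tick a).val = a := rfl

@[simp] theorem cost_tick (a : α) : (tick a).cost = 1 := rfl

@[simp] theorem cost_visit : visit.cost = 1 := rfl

@[simp] theorem val_width (a b : ℕ) : (width a b).val = b - a + 1 := rfl

@[simp] theorem cost_width (a b : ℕ) : (width a b).cost = 2 := rfl

@[simp] theorem val_isWithin (x₁ x₂ lo hi : ℕ) :
    (isWithin x₁ x₂ lo hi).val = (decide (lo ≤ x₁) && decide (x₂ ≤ hi)) := rfl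

@[simp] theorem cost_isWithin (x₁ x₂ lo hi : ℕ) : (isWithin x₁ x₂ lo hi).cost = 3 := rfl

@[simp] theorem val_isOutside (x₁ x₂ lo hi : ℕ) :
    (isOutside x₁ x₂ lo hi).val = (decide (x₂ < lo) || decide (hi < x₁)) := rfl

@[simp] theorem cost_isOutside (x₁ x₂ lo hi : ℕ) : (isOutside x₁ x₂ lo hi).cost = 3 := rfl

@[simp] theorem val_midpoint (x₁ x₂ : ℕ) : (midpoint x₁ x₂).val = (x₁ + x₂) / 2 := rfl

@[simp] theorem cost_midpoint (x₁ x₂ : ℕ) : (midpoint x₁ x₂).cost = 2 := rfl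

@[simp] theorem val_ratio (K : Type) [Field K] (a b : ℕ) : (ratio K a b).val = (a : K) / b := rfl

@[simp] theorem cost_ratio (K : Type) [Field K] (a b : ℕ) : (ratio K a b).cost = 3 := rfl

end Timed

/-! ### Counting visited nodes -/

section Visits

variable {ν : Type}

/-- The tree has the shape of the segment tree on `[x₁ : x₂]`. -/
def Halving : ℕ → ℕ → SegTree ν → Prop
  | x₁, x₂, .leaf _ => x₁ = x₂
  | x₁, x₂, .node _ l r =>
      x₁ < x₂ ∧ Halving x₁ ((x₁ + x₂) / 2) l ∧ Halving ((x₁ + x₂) / 2 + 1) x₂ r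

/-- The number of nodes that an operation on `[lo : hi]` visits in the subtree on `[x₁ : x₂]`,
descending only from nodes that are neither within the range nor disjoint from it. -/
def visits (lo hi : ℕ) : ℕ → ℕ → SegTree ν → ℕ
  | _, _, .leaf _ => 1
  | x₁, x₂, .node _ l r =>
      if (lo ≤ x₁ ∧ x₂ ≤ hi) ∨ x₂ < lo ∨ hi < x₁ then 1
      else 1 + visits lo hi x₁ ((x₁ + x₂) / 2) l + visits lo hi ((x₁ + x₂) / 2 + 1) x₂ r

theorem visits_eq_one {lo hi x₁ x₂ : ℕ} (h : (lo ≤ x₁ ∧ x₂ ≤ hi) ∨ x₂ < lo ∨ hi < x₁)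
    (t : SegTree ν) : visits lo hi x₁ x₂ t = 1 := by
  cases t with
  | leaf v => rfl
  | node v l r => simp only [visits, if_pos h]

theorem one_le_visits (lo hi x₁ x₂ : ℕ) (t : SegTree ν) : 1 ≤ visits lo hi x₁ x₂ t := by
  cases t with
  | leaf v => exact le_rfl
  | node v l r =>
    unfold visits
    split_ifs <;> omega

/-- If the range does not end inside the segment on one of the two sides, then one child of each
node is settled at once. -/
theorem visits_le_of_oneSided {lo hi : ℕ} (t : SegTree ν) : ∀ {x₁ x₂ k : ℕ},
    Halving x₁ x₂ t → x₂ + 1 ≤ x₁ + 2 ^ k → lo ≤ x₁ ∨ x₂ ≤ hi →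
    visits lo hi x₁ x₂ t ≤ 2 * k + 1 := by
  induction t with
  | leaf v => intros; simp [visits]
  | node v l r ihl ihr =>
    rintro x₁ x₂ k ⟨hx, hl, hr⟩ hk hs
    obtain _ | k := k
    · omega
    rw [pow_succ] at hk
    have ihl := @ihl _ _ k hl (by omega)
    have ihr := @ihr _ _ k hr (by omega)
    unfold visits
    split_ifs with h
    · omega
    · rcases hs with hs | hs
      · have hr' := ihr (Or.inl (by omega))
        have hl' := ihl (Or.inl hs)
        by_cases hm : (x₁ + x₂) / 2 ≤ hi
        · have := visits_eq_one (Or.inl ⟨hs, hm⟩) l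
          omega
        · have := visits_eq_one (lo := lo) (x₂ := x₂)
            (Or.inr (Or.inr (show hi < (x₁ + x₂) / 2 + 1 by omega))) r
          omega
      · have hr' := ihr (Or.inr hs)
        have hl' := ihl (Or.inr (by omega))
        by_cases hm : lo ≤ (x₁ + x₂) / 2 + 1
        · have := visits_eq_one (Or.inl ⟨hm, hs⟩) r
          omega
        · have := visits_eq_one (hi := hi) (x₁ := x₁)
            (Or.inr (Or.inl (show (x₁ + x₂) / 2 < lo by omega))) l
          omega

/-- Until the two ends of the range part, only one child of each node is not settled at once;
afterwards both children are one-sided. -/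
theorem visits_le {lo hi : ℕ} (t : SegTree ν) : ∀ {x₁ x₂ k : ℕ},
    Halving x₁ x₂ t → x₂ + 1 ≤ x₁ + 2 ^ k → visits lo hi x₁ x₂ t ≤ 4 * k + 1 := by
  induction t with
  | leaf v => intros; simp [visits]
  | node v l r ihl ihr =>
    rintro x₁ x₂ k ⟨hx, hl, hr⟩ hk
    obtain _ | k := k
    · omega
    rw [pow_succ] at hk
    have hkl : (x₁ + x₂) / 2 + 1 ≤ x₁ + 2 ^ k := by omega
    have hkr : x₂ + 1 ≤ (x₁ + x₂) / 2 + 1 + 2 ^ k := by omega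
    have hl' := ihl hl hkl
    have hr' := ihr hr hkr
    unfold visits
    split_ifs with h
    · omega
    · by_cases h₁ : hi < (x₁ + x₂) / 2 + 1
      · have := visits_eq_one (lo := lo) (x₂ := x₂) (Or.inr (Or.inr h₁)) r
        omega
      by_cases h₂ : (x₁ + x₂) / 2 < lo
      · have := visits_eq_one (hi := hi) (x₁ := x₁) (Or.inr (Or.inl h₂)) l
        omega
      have h₃ := visits_le_of_oneSided (lo := lo) (hi := hi) l hl hkl (Or.inr (by omega))
      have h₄ := visits_le_of_oneSided (lo := lo) (hi := hi) r hr hkr (Or.inl (by omega))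
      omega

end Visits

variable {K : Type} [Field K]

/-! ### Sums over ranges and boxes -/

theorem sum_Icc_halves {M : Type} [AddCommMonoid M] {x₁ x₂ : ℕ} (h : x₁ < x₂) (lo hi : ℕ)
    (f : ℕ → M) :
    ∑ x ∈ Finset.Icc (max lo x₁) (min hi x₂), f x =
      ∑ x ∈ Finset.Icc (max lo x₁) (min hi ((x₁ + x₂) / 2)), f x +
      ∑ x ∈ Finset.Icc (max lo ((x₁ + x₂) / 2 + 1)) (min hi x₂), f x := by
  rw [← Finset.sum_union]
  · congr 1
    ext x
    simp only [Finset.mem_union, Finset.mem_Icc]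
    omega
  · rw [Finset.disjoint_left]
    intro x
    simp only [Finset.mem_Icc]
    omega

theorem sum_Icc_midpoint {M : Type} [AddCommMonoid M] {x₁ x₂ : ℕ} (h : x₁ < x₂) (f : ℕ → M) :
    ∑ x ∈ Finset.Icc x₁ x₂, f x =
      ∑ x ∈ Finset.Icc x₁ ((x₁ + x₂) / 2), f x +
      ∑ x ∈ Finset.Icc ((x₁ + x₂) / 2 + 1) x₂, f x := by
  have := sum_Icc_halves h 0 x₂ f
  rwa [min_self, min_eq_right (show (x₁ + x₂) / 2 ≤ x₂ by omega), Nat.zero_max, Nat.zero_max]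
    at this

theorem card_Icc_eq_width {a b : ℕ} (h : a ≤ b) :
    ((Finset.Icc a b).card : K) = ((b - a + 1 : ℕ) : K) := by
  rw [Nat.card_Icc]
  congr 1
  omega

/-- The indicator function of the range `[lo : hi]`. -/
def rangeInd (K : Type) [Field K] (lo hi x : ℕ) : K := if x ∈ Finset.Icc lo hi then 1 else 0

theorem rangeInd_eq_one {lo hi x : ℕ} (h : lo ≤ x ∧ x ≤ hi) : rangeInd K lo hi x = 1 :=
  if_pos (Finset.mem_Icc.2 h)

theorem rangeInd_eq_zero {lo hi x : ℕ} (h : x < lo ∨ hi < x) : rangeInd K lo hi x = 0 :=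
  if_neg (by rw [Finset.mem_Icc]; omega)

theorem sum_rangeInd_of_meets {lo hi x₁ x₂ : ℕ} (h : max lo x₁ ≤ min hi x₂) :
    ∑ x ∈ Finset.Icc x₁ x₂, rangeInd K lo hi x = ((min hi x₂ - max lo x₁ + 1 : ℕ) : K) := by
  have hI : {x ∈ Finset.Icc x₁ x₂ | x ∈ Finset.Icc lo hi} =
      Finset.Icc (max lo x₁) (min hi x₂) := by
    ext x
    simp only [Finset.mem_filter, Finset.mem_Icc]
    omega
  rw [← card_Icc_eq_width h, ← hI, Finset.card_filter, Nat.cast_sum]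
  exact Finset.sum_congr rfl fun x _ => by simp [rangeInd]

theorem cons_mem_Icc {d : ℕ} (lo hi : Fin (d + 1) → ℕ) (x : ℕ) (y : Fin d → ℕ) :
    (Fin.cons x y : Fin (d + 1) → ℕ) ∈ Finset.Icc lo hi ↔
      x ∈ Finset.Icc (lo 0) (hi 0) ∧ y ∈ Finset.Icc (Fin.tail lo) (Fin.tail hi) := by
  simp only [Finset.mem_Icc, Fin.le_cons, Fin.cons_le]
  tauto

theorem sum_Icc_cons {M : Type} [AddCommMonoid M] {d : ℕ} (lo hi : Fin (d + 1) → ℕ)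
    (f : (Fin (d + 1) → ℕ) → M) :
    ∑ z ∈ Finset.Icc lo hi, f z =
      ∑ x ∈ Finset.Icc (lo 0) (hi 0), ∑ y ∈ Finset.Icc (Fin.tail lo) (Fin.tail hi),
        f (Fin.cons x y) := by
  rw [← Finset.sum_product']
  refine Finset.sum_nbij' (fun z => (z 0, Fin.tail z)) (fun p => Fin.cons p.1 p.2) ?_ ?_ ?_ ?_ ?_
  · intro z hz
    rw [← Fin.cons_self_tail z, cons_mem_Icc] at hz
    exact Finset.mem_product.2 hz
  · rintro ⟨x, y⟩ h
    exact (cons_mem_Icc lo hi x y).2 (Finset.mem_product.1 h)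
  · intro z _
    exact Fin.cons_self_tail z
  · rintro ⟨x, y⟩ _
    simp
  · intro z _
    simp

theorem const_mem_Icc (lo hi : Fin 1 → ℕ) (x : ℕ) :
    (fun _ => x : Fin 1 → ℕ) ∈ Finset.Icc lo hi ↔ x ∈ Finset.Icc (lo 0) (hi 0) := by
  simp [Finset.mem_Icc, Pi.le_def]

theorem sum_Icc_const {M : Type} [AddCommMonoid M] (lo hi : Fin 1 → ℕ) (f : (Fin 1 → ℕ) → M) :
    ∑ z ∈ Finset.Icc lo hi, f z = ∑ x ∈ Finset.Icc (lo 0) (hi 0), f (fun _ => x) := by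
  have eta : ∀ z : Fin 1 → ℕ, (fun _ => z 0) = z := fun z => by
    ext i
    rw [Subsingleton.elim i 0]
  refine Finset.sum_nbij' (fun z => z 0) (fun x _ => x) ?_ ?_ ?_ ?_ ?_
  · intro z hz
    rw [← eta z, const_mem_Icc] at hz
    exact hz
  · intro x hx
    exact (const_mem_Icc lo hi x).2 hx
  · intro z _
    exact eta z
  · intro x _
    rfl
  · intro z _
    rw [eta]

/-- The indicator function of a box. -/
def boxInd (K : Type) [Field K] {d : ℕ} (lo hi z : Fin d → ℕ) : K :=
  if z ∈ Finset.Icc lo hi then 1 else 0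

theorem boxInd_const (lo hi : Fin 1 → ℕ) (x : ℕ) :
    boxInd K lo hi (fun _ => x) = rangeInd K (lo 0) (hi 0) x := by
  simp only [boxInd, rangeInd, const_mem_Icc]

theorem boxInd_cons {d : ℕ} (lo hi : Fin (d + 1) → ℕ) (x : ℕ) (y : Fin d → ℕ) :
    boxInd K lo hi (Fin.cons x y) =
      rangeInd K (lo 0) (hi 0) x * boxInd K (Fin.tail lo) (Fin.tail hi) y := by
  simp only [boxInd, rangeInd, cons_mem_Icc, ite_and]
  split_ifs <;> simp

theorem IsBox.tail {d : ℕ} {size lo hi : Fin (d + 1) → ℕ} (h : IsBox size lo hi) :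
    IsBox (Fin.tail size) (Fin.tail lo) (Fin.tail hi) := fun i => h i.succ

/-! ### The representation invariant -/

/-- The subtree on `[x₁ : x₂]` of a classical segment tree represents the array `B`, where the
lazy updates above the subtree are not counted. A lazy update is an amount for each of the `V`
elements of the surrounding region, so it accounts for `V * lazy` at each position. -/
def InnerRepresents (V : ℕ) : ℕ → ℕ → (ℕ → K) → SegTree (Cell K) → Prop
  | x₁, x₂, B, .leaf v => x₁ = x₂ ∧ v.value = ∑ x ∈ Finset.Icc x₁ x₂, B x
  | x₁, x₂, B, .node v l r =>
      x₁ < x₂ ∧ v.value = ∑ x ∈ Finset.Icc x₁ x₂, B x ∧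
      InnerRepresents V x₁ ((x₁ + x₂) / 2) (fun x => B x - V * v.lazy) l ∧
      InnerRepresents V ((x₁ + x₂) / 2 + 1) x₂ (fun x => B x - V * v.lazy) r

/-- The subtree on `[x₁ : x₂]` of an outer layer represents the array `B`, where the global values
above the subtree are not counted. Here `P V' G s` says that the inner structure `s` represents
`G` when its surrounding region has `V'` elements. -/
def OuterRepresents {α ν : Type} (P : ℕ → (α → K) → ν → Prop) (V : ℕ) :
    ℕ → ℕ → (ℕ → α → K) → SegTree (Layer ν) → Prop
  | x₁, x₂, B, .leaf v => x₁ = x₂ ∧ ∃ G L : α → K,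
      P (V * (x₂ - x₁ + 1)) G v.glob ∧ P (V * (x₂ - x₁ + 1)) L v.loc ∧
      ∀ y, G y + L y = ∑ x ∈ Finset.Icc x₁ x₂, B x y
  | x₁, x₂, B, .node v l r => x₁ < x₂ ∧ ∃ G L : α → K,
      P (V * (x₂ - x₁ + 1)) G v.glob ∧ P (V * (x₂ - x₁ + 1)) L v.loc ∧
      (∀ y, G y + L y = ∑ x ∈ Finset.Icc x₁ x₂, B x y) ∧
      OuterRepresents P V x₁ ((x₁ + x₂) / 2)
        (fun x y => B x y - G y / ((x₂ - x₁ + 1 : ℕ) : K)) l ∧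
      OuterRepresents P V ((x₁ + x₂) / 2 + 1) x₂
        (fun x y => B x y - G y / ((x₂ - x₁ + 1 : ℕ) : K)) r

/-- The `d` innermost layers `t`, inside a region of `V` elements, represent the `d`-dimensional
array `B` of sums over that region. -/
def Represents : (d : ℕ) → (size : Fin d → ℕ) → (V : ℕ) → ((Fin d → ℕ) → K) → DTree K d → Prop
  | 0, _, _, _, _ => True
  | 1, size, V, B, t => InnerRepresents V 1 (size 0) (fun x => B (fun _ => x)) t
  | d + 2, size, V, B, t =>
      OuterRepresents (fun V' B' s => Represents (d + 1) (Fin.tail size) V' B' s)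
        V 1 (size 0) (fun x y => B (Fin.cons x y)) t

theorem InnerRepresents.halving {V : ℕ} (t : SegTree (Cell K)) : ∀ {x₁ x₂ : ℕ} {B : ℕ → K},
    InnerRepresents V x₁ x₂ B t → Halving x₁ x₂ t := by
  induction t with
  | leaf v => exact fun h => h.1
  | node v l r ihl ihr => exact fun h => ⟨h.1, ihl h.2.2.1, ihr h.2.2.2⟩

theorem OuterRepresents.halving {α ν : Type} {P : ℕ → (α → K) → ν → Prop} {V : ℕ}
    (t : SegTree (Layer ν)) : ∀ {x₁ x₂ : ℕ} {B : ℕ → α → K},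
    OuterRepresents P V x₁ x₂ B t → Halving x₁ x₂ t := by
  induction t with
  | leaf v => exact fun h => h.1
  | node v l r ihl ihr =>
    rintro x₁ x₂ B ⟨hx, G, L, -, -, -, hl, hr⟩
    exact ⟨hx, ihl hl, ihr hr⟩

theorem InnerRepresents.value_root {V : ℕ} {t : SegTree (Cell K)} {x₁ x₂ : ℕ} {B : ℕ → K}
    (h : InnerRepresents V x₁ x₂ B t) : t.root.value = ∑ x ∈ Finset.Icc x₁ x₂, B x := by
  cases t with
  | leaf v => exact h.2
  | node v l r => exact h.2.1

/-- Only the entries on the segment of the subtree matter. -/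
theorem InnerRepresents.congr {V : ℕ} (t : SegTree (Cell K)) : ∀ {x₁ x₂ : ℕ} {B B' : ℕ → K},
    InnerRepresents V x₁ x₂ B t → (∀ x, x₁ ≤ x → x ≤ x₂ → B x = B' x) →
    InnerRepresents V x₁ x₂ B' t := by
  have hs : ∀ {x₁ x₂ : ℕ} {B B' : ℕ → K}, (∀ x, x₁ ≤ x → x ≤ x₂ → B x = B' x) →
      ∑ x ∈ Finset.Icc x₁ x₂, B x = ∑ x ∈ Finset.Icc x₁ x₂, B' x := fun h =>
    Finset.sum_congr rfl fun x hx => h x (Finset.mem_Icc.1 hx).1 (Finset.mem_Icc.1 hx).2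
  induction t with
  | leaf v =>
    rintro x₁ x₂ B B' ⟨hx, hv⟩ h
    exact ⟨hx, hv.trans (hs h)⟩
  | node v l r ihl ihr =>
    rintro x₁ x₂ B B' ⟨hx, hv, hl, hr⟩ h
    refine ⟨hx, hv.trans (hs h), ihl hl fun x h₁ h₂ => ?_, ihr hr fun x h₁ h₂ => ?_⟩ <;>
      rw [h x (by omega) (by omega)]

/-- Only the entries on the segment of the subtree matter. -/
theorem OuterRepresents.congr {α ν : Type} {P : ℕ → (α → K) → ν → Prop} {V : ℕ}
    (t : SegTree (Layer ν)) : ∀ {x₁ x₂ : ℕ} {B B' : ℕ → α → K},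
    OuterRepresents P V x₁ x₂ B t → (∀ x, x₁ ≤ x → x ≤ x₂ → B x = B' x) →
    OuterRepresents P V x₁ x₂ B' t := by
  have hs : ∀ {x₁ x₂ : ℕ} {B B' : ℕ → α → K}, (∀ x, x₁ ≤ x → x ≤ x₂ → B x = B' x) →
      ∀ y, ∑ x ∈ Finset.Icc x₁ x₂, B x y = ∑ x ∈ Finset.Icc x₁ x₂, B' x y := fun h y =>
    Finset.sum_congr rfl fun x hx => by
      rw [h x (Finset.mem_Icc.1 hx).1 (Finset.mem_Icc.1 hx).2]
  induction t with
  | leaf v =>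
    rintro x₁ x₂ B B' ⟨hx, G, L, hG, hL, hv⟩ h
    exact ⟨hx, G, L, hG, hL, fun y => (hv y).trans (hs h y)⟩
  | node v l r ihl ihr =>
    rintro x₁ x₂ B B' ⟨hx, G, L, hG, hL, hv, hl, hr⟩ h
    refine ⟨hx, G, L, hG, hL, fun y => (hv y).trans (hs h y), ihl hl fun x h₁ h₂ => ?_,
      ihr hr fun x h₁ h₂ => ?_⟩ <;> rw [h x (by omega) (by omega)]

/-! ### The initial structure -/

theorem innerRepresents_build (V : ℕ) (B : ℕ → K) (x₁ x₂ : ℕ) (h : x₁ ≤ x₂) :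
    InnerRepresents V x₁ x₂ B
      (SegTree.build (fun a b => Cell.mk (∑ x ∈ Finset.Icc a b, B x) 0) x₁ x₂) := by
  induction hn : x₂ - x₁ using Nat.strong_induction_on generalizing x₁ x₂ with
  | _ n ih =>
    -- With zero lazy updates or global values, the remainder left to the children is all of `B`.
    rw [SegTree.build]
    split_ifs with hx
    · refine ⟨hx, rfl, ?_, ?_⟩
      · simpa using ih _ (by omega) x₁ ((x₁ + x₂) / 2) (by omega) rfl
      · simpa using ih _ (by omega) ((x₁ + x₂) / 2 + 1) x₂ (by omega) rfl
    · exact ⟨by omega, rfl⟩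

theorem outerRepresents_build {α ν : Type} {P : ℕ → (α → K) → ν → Prop} (V : ℕ)
    (B : ℕ → α → K) (z : ν) (f : ℕ → ℕ → ν) (hz : ∀ V', P V' (fun _ => 0) z)
    (hf : ∀ V' a b, P V' (fun y => ∑ x ∈ Finset.Icc a b, B x y) (f a b))
    (x₁ x₂ : ℕ) (h : x₁ ≤ x₂) :
    OuterRepresents P V x₁ x₂ B (SegTree.build (fun a b => Layer.mk z (f a b)) x₁ x₂) := by
  induction hn : x₂ - x₁ using Nat.strong_induction_on generalizing x₁ x₂ with
  | _ n ih =>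
    -- With zero lazy updates or global values, the remainder left to the children is all of `B`.
    rw [SegTree.build]
    split_ifs with hx
    · refine ⟨hx, _, _, hz _, hf _ _ _, fun y => zero_add _, ?_, ?_⟩
      · simpa using ih _ (by omega) x₁ ((x₁ + x₂) / 2) (by omega) rfl
      · simpa using ih _ (by omega) ((x₁ + x₂) / 2 + 1) x₂ (by omega) rfl
    · exact ⟨by omega, _, _, hz _, hf _ _ _, fun y => zero_add _⟩

theorem represents_construct : ∀ (d : ℕ) (size : Fin d → ℕ) (V : ℕ) (A : (Fin d → ℕ) → K),
    (∀ i, 1 ≤ size i) → Represents d size V A (construct d size A)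
  | 0, _, _, _, _ => trivial
  | 1, size, V, _, h => innerRepresents_build V _ 1 (size 0) (h 0)
  | d + 2, size, V, A, h =>
      outerRepresents_build V (fun x y => A (Fin.cons x y)) _ _
        (fun V' => represents_construct (d + 1) _ V' _ fun i => h i.succ)
        (fun V' _ _ => represents_construct (d + 1) _ V' _ fun i => h i.succ) 1 (size 0) (h 0)

/-! ### Queries are exact -/

section Queries

variable [CharZero K]

/-- The lazy updates above the subtree enter through `lazy`, which the query accumulates on its way
down. -/
theorem InnerRepresents.val_query {V : ℕ} (hV : V ≠ 0) (Q lo hi : ℕ) (t : SegTree (Cell K)) :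
    ∀ {x₁ x₂ : ℕ} {B : ℕ → K} (lazy : K), InnerRepresents V x₁ x₂ B t →
    (queryInner V Q lo hi x₁ x₂ lazy t).val =
      (Q / V : K) * ∑ x ∈ Finset.Icc (max lo x₁) (min hi x₂), (B x + V * lazy) := by
  have hV' : (V : K) ≠ 0 := Nat.cast_ne_zero.2 hV
  -- The answer at a node within the range.
  have key : ∀ {x₁ x₂ : ℕ} {B : ℕ → K} {v lazy : K}, x₁ ≤ x₂ → lo ≤ x₁ ∧ x₂ ≤ hi →
      v = ∑ x ∈ Finset.Icc x₁ x₂, B x →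
      v * (Q / V) + lazy * ((Q * (x₂ - x₁ + 1) : ℕ) : K) =
      (Q / V : K) * ∑ x ∈ Finset.Icc (max lo x₁) (min hi x₂), (B x + V * lazy) := by
    intro x₁ x₂ B v lazy hx hw hv
    rw [max_eq_right hw.1, min_eq_right hw.2, Finset.sum_add_distrib, Finset.sum_const, ← hv,
      nsmul_eq_mul, card_Icc_eq_width hx, Nat.cast_mul]
    field_simp
  induction t with
  | leaf v =>
    rintro x₁ x₂ B lazy ⟨hx, hv⟩
    by_cases hw : lo ≤ x₁ ∧ x₂ ≤ hi
    · rw [← key hx.le hw hv]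
      simp [queryInner, hw]
    · rw [Finset.Icc_eq_empty (by omega)]
      simp [queryInner, hw]
  | node v l r ihl ihr =>
    rintro x₁ x₂ B lazy ⟨hx, hv, hl, hr⟩
    by_cases hw : lo ≤ x₁ ∧ x₂ ≤ hi
    · rw [← key hx.le hw hv]
      simp [queryInner, hw]
    by_cases ho : x₂ < lo ∨ hi < x₁
    · rw [Finset.Icc_eq_empty (by omega)]
      simp [queryInner, hw, ho]
    · simp only [queryInner, val_bind, val_isWithin, val_isOutside, Bool.and_eq_true,
        Bool.or_eq_true, decide_eq_true_eq, if_neg hw, if_neg ho, val_midpoint, val_tick]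
      have e : ∀ x, B x - V * v.lazy + V * (lazy + v.lazy) = B x + V * lazy := fun x => by ring
      rw [ihl _ hl, ihr _ hr, ← mul_add, sum_Icc_halves hx]
      simp only [e]

/-- If the queries of the next layer are exact on the box `T`, then so are those of this layer on
the product of `[lo : hi]` with `T`. -/
theorem OuterRepresents.val_query {α ν : Type} {P : ℕ → (α → K) → ν → Prop}
    {next : ℕ → ℕ → ν → Timed K} {T : Finset α}
    (hnext : ∀ V' Q' B s, V' ≠ 0 → P V' B s →
      (next V' Q' s).val = (Q' / V' : K) * ∑ y ∈ T, B y)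
    {V : ℕ} (hV : V ≠ 0) (Q : ℕ) {lo hi : ℕ} (hlh : lo ≤ hi) (t : SegTree (Layer ν)) :
    ∀ {x₁ x₂ : ℕ} {B : ℕ → α → K}, OuterRepresents P V x₁ x₂ B t →
    (queryOuter next V Q lo hi x₁ x₂ t).val =
      (Q / V : K) * ∑ x ∈ Finset.Icc (max lo x₁) (min hi x₂), ∑ y ∈ T, B x y := by
  have hV' : (V : K) ≠ 0 := Nat.cast_ne_zero.2 hV
  have hW : ∀ a b : ℕ, V * (b - a + 1) ≠ 0 := fun a b => Nat.mul_ne_zero hV (by omega)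
  -- The answer of a complete query.
  have key : ∀ {x₁ x₂ : ℕ} {B : ℕ → α → K} {G L : α → K}, lo ≤ x₁ ∧ x₂ ≤ hi →
      (∀ y, G y + L y = ∑ x ∈ Finset.Icc x₁ x₂, B x y) →
      (((Q * (x₂ - x₁ + 1) : ℕ) : K) / ((V * (x₂ - x₁ + 1) : ℕ) : K)) * ∑ y ∈ T, G y +
      (((Q * (x₂ - x₁ + 1) : ℕ) : K) / ((V * (x₂ - x₁ + 1) : ℕ) : K)) * ∑ y ∈ T, L y =
      (Q / V : K) * ∑ x ∈ Finset.Icc (max lo x₁) (min hi x₂), ∑ y ∈ T, B x y := by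
    intro x₁ x₂ B G L hw h
    have hw' : ((x₂ - x₁ + 1 : ℕ) : K) ≠ 0 := Nat.cast_ne_zero.2 (by omega)
    rw [max_eq_right hw.1, min_eq_right hw.2, Finset.sum_comm, ← mul_add,
      ← Finset.sum_add_distrib, Finset.sum_congr rfl fun y _ => h y, Nat.cast_mul, Nat.cast_mul,
      mul_div_mul_right _ _ hw']
  induction t with
  | leaf v =>
    rintro x₁ x₂ B ⟨hx, G, L, hG, hL, h⟩
    by_cases hw : lo ≤ x₁ ∧ x₂ ≤ hi
    · rw [← key hw h, ← hnext _ _ _ _ (hW _ _) hG, ← hnext _ _ _ _ (hW _ _) hL]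
      simp [queryOuter, hw]
    · rw [Finset.Icc_eq_empty (by omega)]
      simp [queryOuter, hw]
  | node v l r ihl ihr =>
    rintro x₁ x₂ B ⟨hx, G, L, hG, hL, h, hl, hr⟩
    by_cases hw : lo ≤ x₁ ∧ x₂ ≤ hi
    · rw [← key hw h, ← hnext _ _ _ _ (hW _ _) hG, ← hnext _ _ _ _ (hW _ _) hL]
      simp [queryOuter, hw]
    by_cases ho : x₂ < lo ∨ hi < x₁
    · rw [Finset.Icc_eq_empty (by omega)]
      simp [queryOuter, hw, ho]
    · have hm : max lo x₁ ≤ min hi x₂ := by omega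
      have hw' : ((x₂ - x₁ + 1 : ℕ) : K) ≠ 0 := Nat.cast_ne_zero.2 (by omega)
      simp only [queryOuter, val_bind, val_isWithin, val_isOutside, Bool.and_eq_true,
        Bool.or_eq_true, decide_eq_true_eq, if_neg hw, if_neg ho, val_midpoint, val_tick,
        val_width]
      rw [ihl hl, ihr hr, hnext _ _ _ _ (hW _ _) hG, add_assoc, ← mul_add, ← sum_Icc_halves hx]
      simp only [Finset.sum_sub_distrib, Finset.sum_const, nsmul_eq_mul, card_Icc_eq_width hm,
        ← Finset.sum_div, Nat.cast_mul]
      field_simp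
      ring

theorem Represents.val_query : ∀ {d : ℕ} (_ : 1 ≤ d) {size lo hi : Fin d → ℕ} {V : ℕ} (Q : ℕ)
    {B : (Fin d → ℕ) → K} {t : DTree K d}, V ≠ 0 → IsBox size lo hi → Represents d size V B t →
    (queryFrom d size lo hi V Q t).val = (Q / V : K) * ∑ x ∈ Finset.Icc lo hi, B x
  | 1, _, size, lo, hi, V, Q, B, t, hV, hb, h => by
    have := InnerRepresents.val_query hV Q (lo 0) (hi 0) t 0 h
    rw [max_eq_left (hb 0).1, min_eq_left (hb 0).2.2] at this
    simp only [mul_zero, add_zero] at this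
    rw [sum_Icc_const, ← this]
    rfl
  | d + 2, _, size, lo, hi, V, Q, B, t, hV, hb, h => by
    have := OuterRepresents.val_query (T := Finset.Icc (Fin.tail lo) (Fin.tail hi))
      (next := fun V' Q' s => do
        let size' ← tick (Fin.tail size)
        let lo' ← tick (Fin.tail lo)
        let hi' ← tick (Fin.tail hi)
        queryFrom (d + 1) size' lo' hi' V' Q' s)
      (fun V' Q' B' s hV' hs => Represents.val_query (by omega) Q' hV' hb.tail hs)
      hV Q (hb 0).2.1 t h
    rw [max_eq_left (hb 0).1, min_eq_left (hb 0).2.2] at this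
    rw [sum_Icc_cons, ← this]
    rfl

end Queries

/-! ### Updates preserve the invariant -/

theorem InnerRepresents.update (V lo hi : ℕ) (c : K) (t : SegTree (Cell K)) :
    ∀ {x₁ x₂ : ℕ} {B : ℕ → K}, InnerRepresents V x₁ x₂ B t →
    InnerRepresents V x₁ x₂ (fun x => B x + V * c * rangeInd K lo hi x)
      (updateInner V lo hi c x₁ x₂ t).val := by
  -- The new value of a node within the range.
  have key : ∀ {x₁ x₂ : ℕ} {B : ℕ → K} {v : K}, x₁ ≤ x₂ → lo ≤ x₁ ∧ x₂ ≤ hi →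
      v = ∑ x ∈ Finset.Icc x₁ x₂, B x →
      v + c * ((V * (x₂ - x₁ + 1) : ℕ) : K) =
        ∑ x ∈ Finset.Icc x₁ x₂, (B x + V * c * rangeInd K lo hi x) := by
    intro x₁ x₂ B v hx hw hv
    rw [Finset.sum_add_distrib, ← Finset.mul_sum, sum_rangeInd_of_meets (by omega), ← hv,
      max_eq_right hw.1, min_eq_right hw.2, Nat.cast_mul]
    ring
  induction t with
  | leaf v =>
    intro x₁ x₂ B h
    by_cases hw : lo ≤ x₁ ∧ x₂ ≤ hi
    · simp only [updateInner, val_bind, val_isWithin, Bool.and_eq_true, decide_eq_true_eq,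
        if_pos hw, val_tick, val_width]
      exact ⟨h.1, key h.1.le hw h.2⟩
    · simp only [updateInner, val_bind, val_isWithin, Bool.and_eq_true, decide_eq_true_eq,
        if_neg hw, val_pure]
      have hx := h.1
      refine h.congr _ fun x h₁ h₂ => ?_
      rw [rangeInd_eq_zero (by omega), mul_zero, add_zero]
  | node v l r ihl ihr =>
    intro x₁ x₂ B h
    by_cases hw : lo ≤ x₁ ∧ x₂ ≤ hi
    · obtain ⟨hx, hv, hl, hr⟩ := h
      simp only [updateInner, val_bind, val_isWithin, Bool.and_eq_true, decide_eq_true_eq,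
        if_pos hw, val_tick, val_width]
      refine ⟨hx, key hx.le hw hv, hl.congr _ fun x h₁ h₂ => ?_, hr.congr _ fun x h₁ h₂ => ?_⟩ <;>
        · simp only [rangeInd_eq_one (show lo ≤ x ∧ x ≤ hi by omega)]
          ring
    by_cases ho : x₂ < lo ∨ hi < x₁
    · simp only [updateInner, val_bind, val_isWithin, val_isOutside, Bool.and_eq_true,
        Bool.or_eq_true, decide_eq_true_eq, if_neg hw, if_pos ho, val_pure]
      refine h.congr _ fun x h₁ h₂ => ?_
      rw [rangeInd_eq_zero (by omega), mul_zero, add_zero]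
    · obtain ⟨hx, -, hl, hr⟩ := h
      simp only [updateInner, val_bind, val_isWithin, val_isOutside, Bool.and_eq_true,
        Bool.or_eq_true, decide_eq_true_eq, if_neg hw, if_neg ho, val_midpoint, val_tick,
        val_width]
      have e : ∀ x, B x - V * v.lazy + V * c * rangeInd K lo hi x =
          B x + V * c * rangeInd K lo hi x - V * v.lazy := fun x => by ring
      have hl' := ihl hl
      have hr' := ihr hr
      refine ⟨hx, ?_, hl'.congr _ fun x _ _ => e x, hr'.congr _ fun x _ _ => e x⟩
      rw [hl'.value_root, hr'.value_root, ← sum_Icc_midpoint hx]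
      simp only [e, Finset.sum_sub_distrib, Finset.sum_const, nsmul_eq_mul,
        card_Icc_eq_width hx.le, Nat.cast_mul]
      ring

section Updates

variable [CharZero K]

/-- If the updates of the next layer add `V' * c'` times the indicator function `χ` of a box, then
those of this layer add `V * c` times the indicator function of the product of `[lo : hi]` with
that box. -/
theorem OuterRepresents.update {α ν : Type} {P : ℕ → (α → K) → ν → Prop}
    {next : ℕ → K → ν → Timed ν} {χ : α → K}
    (hnext : ∀ V' c' B s, P V' B s → P V' (fun y => B y + V' * c' * χ y) (next V' c' s).val)
    (V : ℕ) {lo hi : ℕ} (hlh : lo ≤ hi) (c : K) (t : SegTree (Layer ν)) :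
    ∀ {x₁ x₂ : ℕ} {B : ℕ → α → K}, OuterRepresents P V x₁ x₂ B t →
    OuterRepresents P V x₁ x₂ (fun x y => B x y + V * c * (rangeInd K lo hi x * χ y))
      (updateOuter next V lo hi c x₁ x₂ t).val := by
  -- The total that an update adds to the column of `y` in a node that meets the range.
  have total : ∀ {x₁ x₂ : ℕ} {B : ℕ → α → K} {S : K} (y : α), max lo x₁ ≤ min hi x₂ →
      S = ∑ x ∈ Finset.Icc x₁ x₂, B x y →
      S + V * c * (((min hi x₂ - max lo x₁ + 1 : ℕ) : K) * χ y) =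
        ∑ x ∈ Finset.Icc x₁ x₂, (B x y + V * c * (rangeInd K lo hi x * χ y)) := by
    intro x₁ x₂ B S y hm hS
    rw [Finset.sum_add_distrib, ← Finset.mul_sum, ← Finset.sum_mul, sum_rangeInd_of_meets hm, hS]
  -- An intended update.
  have key : ∀ {x₁ x₂ : ℕ} {B : ℕ → α → K} {G L : α → K}, x₁ ≤ x₂ → lo ≤ x₁ ∧ x₂ ≤ hi →
      (∀ y, G y + L y = ∑ x ∈ Finset.Icc x₁ x₂, B x y) →
      ∀ y, (G y + ((V * (x₂ - x₁ + 1) : ℕ) : K) * c * χ y) + L y =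
        ∑ x ∈ Finset.Icc x₁ x₂, (B x y + V * c * (rangeInd K lo hi x * χ y)) := by
    intro x₁ x₂ B G L hx hw h y
    rw [← total y (by omega) (h y), max_eq_right hw.1, min_eq_right hw.2, Nat.cast_mul]
    ring
  induction t with
  | leaf v =>
    intro x₁ x₂ B h
    by_cases hw : lo ≤ x₁ ∧ x₂ ≤ hi
    · obtain ⟨hx, G, L, hG, hL, h⟩ := h
      simp only [updateOuter, val_bind, val_isWithin, Bool.and_eq_true, decide_eq_true_eq,
        if_pos hw, val_tick, val_width]
      exact ⟨hx, _, L, hnext _ c _ _ hG, hL, key hx.le hw h⟩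
    · simp only [updateOuter, val_bind, val_isWithin, Bool.and_eq_true, decide_eq_true_eq,
        if_neg hw, val_pure]
      have hx := h.1
      refine h.congr _ fun x h₁ h₂ => ?_
      simp only [rangeInd_eq_zero (show x < lo ∨ hi < x by omega), zero_mul, mul_zero, add_zero]
  | node v l r ihl ihr =>
    intro x₁ x₂ B h
    have hw' : ((x₂ - x₁ + 1 : ℕ) : K) ≠ 0 := Nat.cast_ne_zero.2 (by omega)
    by_cases hw : lo ≤ x₁ ∧ x₂ ≤ hi
    · obtain ⟨hx, G, L, hG, hL, h, hl, hr⟩ := h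
      simp only [updateOuter, val_bind, val_isWithin, Bool.and_eq_true, decide_eq_true_eq,
        if_pos hw, val_tick, val_width]
      refine ⟨hx, _, L, hnext _ c _ _ hG, hL, key hx.le hw h, hl.congr _ fun x h₁ h₂ => ?_,
        hr.congr _ fun x h₁ h₂ => ?_⟩ <;>
        · funext y
          simp only [rangeInd_eq_one (show lo ≤ x ∧ x ≤ hi by omega), Nat.cast_mul]
          field_simp
          ring
    by_cases ho : x₂ < lo ∨ hi < x₁
    · simp only [updateOuter, val_bind, val_isWithin, val_isOutside, Bool.and_eq_true,
        Bool.or_eq_true, decide_eq_true_eq, if_neg hw, if_pos ho, val_pure]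
      refine h.congr _ fun x h₁ h₂ => ?_
      simp only [rangeInd_eq_zero (show x < lo ∨ hi < x by omega), zero_mul, mul_zero, add_zero]
    · obtain ⟨hx, G, L, hG, hL, h, hl, hr⟩ := h
      simp only [updateOuter, val_bind, val_isWithin, val_isOutside, Bool.and_eq_true,
        Bool.or_eq_true, decide_eq_true_eq, if_neg hw, if_neg ho, val_midpoint, val_tick,
        val_width, val_ratio]
      refine ⟨hx, G, _, hG, hnext _ _ _ _ hL, fun y => ?_, (ihl hl).congr _ fun x _ _ => ?_,
        (ihr hr).congr _ fun x _ _ => ?_⟩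
      · rw [← total y (by omega) (h y), Nat.cast_mul]
        field_simp
        ring
      · funext y
        ring
      · funext y
        ring

theorem Represents.update : ∀ {d : ℕ} (_ : 1 ≤ d) {size lo hi : Fin d → ℕ} {V : ℕ} (c : K)
    {B : (Fin d → ℕ) → K} {t : DTree K d}, IsBox size lo hi → Represents d size V B t →
    Represents d size V (fun x => B x + V * c * boxInd K lo hi x)
      (updateFrom d size lo hi V c t).val
  | 1, _, size, lo, hi, V, c, B, t, _, h => by
    have := InnerRepresents.update V (lo 0) (hi 0) c t h
    simp only [← boxInd_const] at this
    exact this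
  | d + 2, _, size, lo, hi, V, c, B, t, hb, h => by
    have := OuterRepresents.update (χ := boxInd K (Fin.tail lo) (Fin.tail hi))
      (next := fun V' c' s => do
        let size' ← tick (Fin.tail size)
        let lo' ← tick (Fin.tail lo)
        let hi' ← tick (Fin.tail hi)
        updateFrom (d + 1) size' lo' hi' V' c' s)
      (fun V' c' B' s hs => Represents.update (by omega) c' hb.tail hs)
      V (hb 0).2.1 c t h
    simp only [← boxInd_cons] at this
    exact this

theorem represents_foldl {d : ℕ} (hd : 1 ≤ d) {size : Fin d → ℕ} (requests : List (Request K d)) :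
    ∀ {A : (Fin d → ℕ) → K} {t : DTree K d}, (∀ q ∈ requests, IsBox size q.lo q.hi) →
    Represents d size 1 A t →
    Represents d size 1 (requests.foldl Request.onArray A)
      (requests.foldl (Request.onTree size) t) := by
  induction requests with
  | nil => exact fun _ h => h
  | cons q qs ih =>
    intro A t hq h
    refine ih (fun p hp => hq p (List.mem_cons_of_mem _ hp)) ?_
    have hA : q.onArray A = fun x => A x + (1 : ℕ) * q.c * boxInd K q.lo q.hi x := by
      funext x
      unfold Request.onArray boxInd
      split_ifs <;> simp
    rw [hA]
    exact h.update hd q.c (hq q List.mem_cons_self)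

end Updates

/-! ### Cost of the operations -/

theorem cost_updateInner_le (V lo hi : ℕ) (c : K) (t : SegTree (Cell K)) : ∀ x₁ x₂ : ℕ,
    (updateInner V lo hi c x₁ x₂ t).cost ≤ 40 * visits lo hi x₁ x₂ t := by
  induction t with
  | leaf v =>
    intro x₁ x₂
    by_cases hw : lo ≤ x₁ ∧ x₂ ≤ hi <;> simp [updateInner, visits, hw]
  | node v l r ihl ihr =>
    intro x₁ x₂
    have hv := one_le_visits lo hi x₁ x₂ (.node v l r)
    by_cases hw : lo ≤ x₁ ∧ x₂ ≤ hi
    · simp [updateInner, hw]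
      omega
    by_cases ho : x₂ < lo ∨ hi < x₁
    · simp [updateInner, hw, ho]
      omega
    · have hl := ihl x₁ ((x₁ + x₂) / 2)
      have hr := ihr ((x₁ + x₂) / 2 + 1) x₂
      simp [updateInner, visits, hw, ho]
      omega

theorem cost_queryInner_le (V Q lo hi : ℕ) (t : SegTree (Cell K)) : ∀ (x₁ x₂ : ℕ) (lazy : K),
    (queryInner V Q lo hi x₁ x₂ lazy t).cost ≤ 40 * visits lo hi x₁ x₂ t := by
  induction t with
  | leaf v =>
    intro x₁ x₂ lazy
    by_cases hw : lo ≤ x₁ ∧ x₂ ≤ hi <;> simp [queryInner, visits, hw]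
  | node v l r ihl ihr =>
    intro x₁ x₂ lazy
    have hv := one_le_visits lo hi x₁ x₂ (.node v l r)
    by_cases hw : lo ≤ x₁ ∧ x₂ ≤ hi
    · simp [queryInner, hw]
      omega
    by_cases ho : x₂ < lo ∨ hi < x₁
    · simp [queryInner, hw, ho]
      omega
    · have hl := ihl x₁ ((x₁ + x₂) / 2) (lazy + v.lazy)
      have hr := ihr ((x₁ + x₂) / 2 + 1) x₂ (lazy + v.lazy)
      simp [queryInner, visits, hw, ho]
      omega

theorem OuterRepresents.cost_update_le {α ν : Type} {P : ℕ → (α → K) → ν → Prop}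
    {next : ℕ → K → ν → Timed ν} {M : ℕ}
    (hnext : ∀ V' c' B s, P V' B s → (next V' c' s).cost ≤ M)
    (V lo hi : ℕ) (c : K) (t : SegTree (Layer ν)) :
    ∀ {x₁ x₂ : ℕ} {B : ℕ → α → K}, OuterRepresents P V x₁ x₂ B t →
    (updateOuter next V lo hi c x₁ x₂ t).cost ≤ (30 + 2 * M) * visits lo hi x₁ x₂ t := by
  induction t with
  | leaf v =>
    rintro x₁ x₂ B ⟨-, G, L, hG, -, -⟩
    have hg := hnext _ c _ _ hG
    by_cases hw : lo ≤ x₁ ∧ x₂ ≤ hi <;> simp [updateOuter, visits, hw] <;> omega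
  | node v l r ihl ihr =>
    rintro x₁ x₂ B ⟨-, G, L, hG, hL, -, hl, hr⟩
    have hv := Nat.mul_le_mul_left (30 + 2 * M) (one_le_visits lo hi x₁ x₂ (.node v l r))
    have hg := hnext _ c _ _ hG
    by_cases hw : lo ≤ x₁ ∧ x₂ ≤ hi
    · simp [updateOuter, hw]
      omega
    by_cases ho : x₂ < lo ∨ hi < x₁
    · simp [updateOuter, hw, ho]
      omega
    · have hl := ihl hl
      have hr := ihr hr
      have hn := fun c' => hnext _ c' _ _ hL
      simp only [updateOuter, visits, cost_bind, val_isWithin, val_isOutside,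
        Bool.and_eq_true, Bool.or_eq_true, decide_eq_true_eq, if_neg hw, if_neg ho,
        if_neg (not_or.2 ⟨hw, ho⟩), val_midpoint, val_tick, val_width, val_ratio, cost_visit,
        cost_isWithin, cost_isOutside, cost_midpoint, cost_tick, cost_width, cost_ratio]
      have hn := hn (c * (((min hi x₂ - max lo x₁ + 1 : ℕ) : K) / ((x₂ - x₁ + 1 : ℕ) : K)))
      rw [mul_add (30 + 2 * M), mul_add (30 + 2 * M)]
      omega

theorem OuterRepresents.cost_query_le {α ν : Type} {P : ℕ → (α → K) → ν → Prop}
    {next : ℕ → ℕ → ν → Timed K} {M : ℕ}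
    (hnext : ∀ V' Q' B s, P V' B s → (next V' Q' s).cost ≤ M)
    (V Q lo hi : ℕ) (t : SegTree (Layer ν)) :
    ∀ {x₁ x₂ : ℕ} {B : ℕ → α → K}, OuterRepresents P V x₁ x₂ B t →
    (queryOuter next V Q lo hi x₁ x₂ t).cost ≤ (30 + 2 * M) * visits lo hi x₁ x₂ t := by
  induction t with
  | leaf v =>
    rintro x₁ x₂ B ⟨-, G, L, hG, hL, -⟩
    have hg := hnext _ (Q * (x₂ - x₁ + 1)) _ _ hG
    have hl := hnext _ (Q * (x₂ - x₁ + 1)) _ _ hL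
    by_cases hw : lo ≤ x₁ ∧ x₂ ≤ hi <;> simp [queryOuter, visits, hw] <;> omega
  | node v l r ihl ihr =>
    rintro x₁ x₂ B ⟨-, G, L, hG, hL, -, hl, hr⟩
    have hv := Nat.mul_le_mul_left (30 + 2 * M) (one_le_visits lo hi x₁ x₂ (.node v l r))
    by_cases hw : lo ≤ x₁ ∧ x₂ ≤ hi
    · have hg := hnext _ (Q * (x₂ - x₁ + 1)) _ _ hG
      have hl := hnext _ (Q * (x₂ - x₁ + 1)) _ _ hL
      simp [queryOuter, hw]
      omega
    by_cases ho : x₂ < lo ∨ hi < x₁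
    · simp [queryOuter, hw, ho]
      omega
    · have hl := ihl hl
      have hr := ihr hr
      have hg := hnext _ (Q * (min hi x₂ - max lo x₁ + 1)) _ _ hG
      simp only [queryOuter, visits, cost_bind, val_isWithin, val_isOutside,
        Bool.and_eq_true, Bool.or_eq_true, decide_eq_true_eq, if_neg hw, if_neg ho,
        if_neg (not_or.2 ⟨hw, ho⟩), val_midpoint, val_tick, val_width, cost_visit,
        cost_isWithin, cost_isOutside, cost_midpoint, cost_tick, cost_width]
      rw [mul_add (30 + 2 * M), mul_add (30 + 2 * M)]
      omega

/-- A bound for the cost of an operation on `d` layers whose segments have at most `2 ^ k`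
elements: at most `4 * k + 1` visited nodes per layer, with at most two calls to the next layer and
`40` other steps at each of them. These `40` steps leave room for the six that pass the corners of
the box to two calls, besides the `30` of the outer layer itself. -/
def costBound : ℕ → ℕ → ℕ
  | 0, _ => 0
  | d + 1, k => (40 + 2 * costBound d k) * (4 * k + 1)

theorem Represents.cost_update_le {k : ℕ} : ∀ {d : ℕ} {size : Fin d → ℕ} (lo hi : Fin d → ℕ)
    {V : ℕ} (c : K) {B : (Fin d → ℕ) → K} {t : DTree K d}, (∀ i, size i ≤ 2 ^ k) →
    Represents d size V B t → (updateFrom d size lo hi V c t).cost ≤ costBound d k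
  | 0, _, _, _, _, _, _, _, _, _ => le_rfl
  | 1, size, lo, hi, V, c, B, t, hk, h =>
    (cost_updateInner_le V (lo 0) (hi 0) c t 1 (size 0)).trans
      (Nat.mul_le_mul_left 40
        (visits_le t (InnerRepresents.halving t h) (by have := hk 0; omega)))
  | d + 2, size, lo, hi, V, c, B, t, hk, h => by
    refine (OuterRepresents.cost_update_le (M := 3 + costBound (d + 1) k)
      (fun V' c' B' s hs => ?_) V (lo 0) (hi 0) c t h).trans
      (Nat.mul_le_mul ?_ (visits_le t (OuterRepresents.halving t h) (by have := hk 0; omega)))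
    · have := Represents.cost_update_le (size := Fin.tail size) (Fin.tail lo) (Fin.tail hi) c'
        (fun i => hk i.succ) hs
      simp only [cost_bind, val_tick, cost_tick]
      omega
    · omega

theorem Represents.cost_query_le {k : ℕ} : ∀ {d : ℕ} {size : Fin d → ℕ} (lo hi : Fin d → ℕ)
    {V : ℕ} (Q : ℕ) {B : (Fin d → ℕ) → K} {t : DTree K d}, (∀ i, size i ≤ 2 ^ k) →
    Represents d size V B t → (queryFrom d size lo hi V Q t).cost ≤ costBound d k
  | 0, _, _, _, _, _, _, _, _, _ => le_rfl
  | 1, size, lo, hi, V, Q, B, t, hk, h =>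
    (cost_queryInner_le V Q (lo 0) (hi 0) t 1 (size 0) 0).trans
      (Nat.mul_le_mul_left 40
        (visits_le t (InnerRepresents.halving t h) (by have := hk 0; omega)))
  | d + 2, size, lo, hi, V, Q, B, t, hk, h => by
    refine (OuterRepresents.cost_query_le (M := 3 + costBound (d + 1) k)
      (fun V' Q' B' s hs => ?_) V Q (lo 0) (hi 0) t h).trans
      (Nat.mul_le_mul ?_ (visits_le t (OuterRepresents.halving t h) (by have := hk 0; omega)))
    · have := Represents.cost_query_le (size := Fin.tail size) (Fin.tail lo) (Fin.tail hi) Q'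
        (fun i => hk i.succ) hs
      simp only [cost_bind, val_tick, cost_tick]
      omega
    · omega

theorem exists_costBound_le (d : ℕ) : ∃ C : ℕ, ∀ k, 1 ≤ k → costBound d k ≤ C * k ^ d := by
  induction d with
  | zero => exact ⟨0, fun k _ => by simp [costBound]⟩
  | succ d ih =>
    obtain ⟨C, hC⟩ := ih
    refine ⟨(40 + 2 * C) * 5, fun k hk => ?_⟩
    have h₁ : 40 + 2 * costBound d k ≤ (40 + 2 * C) * k ^ d := by
      have := hC k hk
      have := Nat.one_le_pow d k hk
      nlinarith
    calc costBound (d + 1) k ≤ (40 + 2 * C) * k ^ d * (5 * k) :=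
          Nat.mul_le_mul h₁ (by omega)
      _ = (40 + 2 * C) * 5 * k ^ (d + 1) := by ring

/-- The rounding in `Nat.clog` is absorbed by the factor `2`, since `logb 2 n ≥ 1`. -/
theorem clog_le_two_mul_logb {n : ℕ} (hn : 2 ≤ n) : (Nat.clog 2 n : ℝ) ≤ 2 * Real.logb 2 n := by
  have h₁ : (1 : ℝ) ≤ Real.logb 2 n := by
    rw [Real.le_logb_iff_rpow_le one_lt_two (by positivity), Real.rpow_one]
    exact_mod_cast hn
  have h₂ : ((Nat.clog 2 n - 1 : ℕ) : ℝ) ≤ Real.logb 2 n := by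
    rw [Real.le_logb_iff_rpow_le one_lt_two (by positivity), Real.rpow_natCast]
    exact_mod_cast (Nat.pow_pred_clog_lt_self one_lt_two (by omega)).le
  have h₃ : (Nat.clog 2 n : ℝ) ≤ ((Nat.clog 2 n - 1 : ℕ) : ℝ) + 1 := by
    exact_mod_cast (by omega : Nat.clog 2 n ≤ Nat.clog 2 n - 1 + 1)
  linarith

end NestedSegTree
open NestedSegTree in
theorem theorem4 (d : ℕ) (hd : 1 ≤ d) :
    ∃ C : ℝ, ∀ (K : Type) [Field K] [CharZero K] (n : ℕ), 2 ≤ n →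
      ∀ size : Fin d → ℕ, (∀ i, 1 ≤ size i ∧ size i ≤ n) →
      ∀ (A : (Fin d → ℕ) → K) (requests : List (Request K d)),
        (∀ q ∈ requests, IsBox size q.lo q.hi) →
        ∀ lo hi : Fin d → ℕ, IsBox size lo hi →
          (query size lo hi (requests.foldl (Request.onTree size) (construct d size A))).val
              = ∑ x ∈ Finset.Icc lo hi, requests.foldl Request.onArray A x ∧
          ((query size lo hi
              (requests.foldl (Request.onTree size) (construct d size A))).cost : ℝ)
              ≤ C * Real.logb 2 n ^ d ∧
          ∀ c : K,
            ((update size lo hi c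
                (requests.foldl (Request.onTree size) (construct d size A))).cost : ℝ)
              ≤ C * Real.logb 2 n ^ d := by
  obtain ⟨C, hC⟩ := exists_costBound_le d
  refine ⟨C * 2 ^ d, ?_⟩
  intro K _ _ n hn size hsize A requests hreq lo hi hbox
  have hrep := represents_foldl hd requests hreq
    (represents_construct d size 1 A fun i => (hsize i).1)
  have hk : ∀ i, size i ≤ 2 ^ Nat.clog 2 n := fun i =>
    (hsize i).2.trans (Nat.le_pow_clog one_lt_two n)
  have hbound : ∀ m : ℕ, m ≤ costBound d (Nat.clog 2 n) →
      (m : ℝ) ≤ C * 2 ^ d * Real.logb 2 n ^ d := by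
    intro m hm
    have hm' : (m : ℝ) ≤ C * (Nat.clog 2 n : ℝ) ^ d := by
      exact_mod_cast hm.trans (hC _ (Nat.clog_pos one_lt_two hn))
    refine hm'.trans ?_
    rw [mul_assoc, ← mul_pow]
    gcongr
    exact clog_le_two_mul_logb hn
  refine ⟨?_, hbound _ (hrep.cost_query_le lo hi 1 hk),
    fun c => hbound _ (hrep.cost_update_le lo hi c hk)⟩
  have hval := hrep.val_query hd 1 one_ne_zero hbox
  rw [Nat.cast_one, div_one, one_mul] at hval
  exact hval
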